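/- Let $\mathcal X$ be a set of datapoints, $\mathcal F:\mathcal X\to\mathbb R^d$ a processing function, $\mathcal{CP}:\mathbb R^d\to\mathbb R^d$ a clipping operator (any map), $\sigma>0$ and $q_1,q_2\in[0,1]$. A dataset is a finite collection of datapoints; two datasets are adjacent, $X\sim X'$, if one is obtained from the other by adding one datapoint. A randomized algorithm $\mathcal M$ satisfies $(\alpha,\epsilon)$-RDP ($\alpha>1$) if for all $X\sim X'$ the laws $P,Q$ of $\mathcal M(X),\mathcal M(X')$ satisfy $\mathsf D_\alpha(P\|Q)=\frac1{\alpha-1}\log\int\big(\tfrac{dP}{dQ}\big)^{\alpha}dQ\le\epsilon$ (with $\mathsf D_\alpha=+\infty$ if $P\not\ll Q$). Poisson sampling with rate $q$ keeps each datapoint independently with probability $q$. $q_2$-coordinate-wise sampling with Gaussian noise: on input $X=\{x_1,\dots,x_n\}$, independently for each coordinate $l=1,\dots,d$, draw an index set $\mathcal I_l\subseteq\{1,\dots,n\}$ by Poisson sampling with rate $q_2$ and output $o_l=\sum_{i\in\mathcal I_l}\mathcal{CP}(\mathcal F(x_i))(l)+e_l$, where $e_l\sim\mathcal N(0,\sigma^2)$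 is independent noise. $(q_1,q_2)$-twice sampling: draw $\mathcal I\subseteq\{1,\dots,n\}$ by Poisson sampling with rate $q_1$ and apply the preceding algorithm to $X_{\mathcal I}=\{x_i:i\in\mathcal I\}$. Suppose that the algorithm with $q_2$-coordinate-wise sampling satisfies $(\alpha_0,\epsilon_0(\alpha_0))$-RDP for every integer $\alpha_0\ge2$, where $\epsilon_0(\alpha_0)\in\mathbb R$. Then for every integer $\alpha\ge2$ the algorithm with $(q_1,q_2)$-twice sampling satisfies $(\alpha,\epsilon(\alpha))$-RDP, where $$\epsilon(\alpha)=\frac1{\alpha-1}\log\Big((1-q_1)^\alpha+\sum_{v=1}^{\alpha}\binom{\alpha}{v}(1-q_1)^{\alpha-v}q_1^{v}e^{(v-1)\epsilon_0(v)}\Big).$$ (The term $v=1$ does not involve $\epsilon_0(1)$, since $e^{0}=1$.) -/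

import Mathlib

open MeasureTheory ProbabilityTheory
open scoped NNReal ENNReal

noncomputable section

/-- A dataset is a finite collection of datapoints (repetitions are allowed, order is irrelevant).
Two datasets are adjacent if one arises from the other by adding a single datapoint. -/
def AdjacentDatasets {𝒳 : Type*} (X X' : Multiset 𝒳) : Prop :=
  ∃ x : 𝒳, X = x ::ₘ X' ∨ X' = x ::ₘ X

open Classical in
/-- The Rényi divergence of order `a > 1`,
`D_a(P ‖ Q) = (a - 1)⁻¹ * log ∫ (dP/dQ) ^ a dQ`, equal to `+∞` if `P` is not absolutely
continuous with respect to `Q` (or if the integral is infinite). -/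
def renyiDivergence {Ω : Type*} [MeasurableSpace Ω] (a : ℝ) (P Q : Measure Ω) : EReal :=
  if P ≪ Q then (((a - 1)⁻¹ : ℝ) : EReal) * ENNReal.log (∫⁻ o, (P.rnDeriv Q o) ^ a ∂Q) else ⊤

/-- `(a, ε)`-Rényi differential privacy (`a > 1`) of a randomized algorithm, which is given by the
law `M X` of its output on each dataset `X`. Adjacency is symmetric, so both directions of the
divergence are bounded. -/
def IsRDP {𝒳 Ω : Type*} [MeasurableSpace Ω] (M : Multiset 𝒳 → Measure Ω) (a ε : ℝ) : Prop :=
  ∀ X X' : Multiset 𝒳, AdjacentDatasets X X' → renyiDivergence a (M X) (M X') ≤ (ε : EReal)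

/-- Poisson sampling with rate `q`: every datapoint of `X` is kept independently with probability
`q`, so that each of the `2 ^ |X|` subcollections `S` of `X` (`Multiset.powerset` lists them with
multiplicity, one for every set of positions) is selected with probability
`q ^ |S| * (1 - q) ^ (|X| - |S|)`. If a randomized algorithm with output law `κ S` is then run on
the selected `S`, the law of the output is the following mixture. -/
def poissonSampled {𝒳 Ω : Type*} [MeasurableSpace Ω] (q : unitInterval)
    (κ : Multiset 𝒳 → Measure Ω) (X : Multiset 𝒳) : Measure Ω :=
  (X.powerset.map fun S =>
    (unitInterval.toNNReal q ^ S.card *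
      unitInterval.toNNReal (unitInterval.symm q) ^ (X.card - S.card)) • κ S).sum

/-- Private aggregation with `q`-coordinate-wise Poisson sampling: for each coordinate `l`
independently, a Poisson sample `S` of rate `q` is drawn from `X`, and the output coordinate is
`∑_{x ∈ S} CP (F x) l` plus independent noise `N(0, σ²)`. -/
def coordinateSampling {𝒳 : Type*} {d : ℕ} (F : 𝒳 → Fin d → ℝ)
    (CP : (Fin d → ℝ) → Fin d → ℝ) (σ : ℝ≥0) (q : unitInterval) (X : Multiset 𝒳) :
    Measure (Fin d → ℝ) :=
  Measure.pi fun l : Fin d =>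
    poissonSampled q (fun S => gaussianReal (S.map fun x => CP (F x) l).sum (σ ^ 2)) X

/-- `(q₁, q₂)`-twice sampling: input-wise Poisson sampling with rate `q₁`, followed by the
aggregation with `q₂`-coordinate-wise Poisson sampling applied to the selected subcollection. -/
def twiceSampling {𝒳 : Type*} {d : ℕ} (F : 𝒳 → Fin d → ℝ)
    (CP : (Fin d → ℝ) → Fin d → ℝ) (σ : ℝ≥0) (q₁ q₂ : unitInterval) :
    Multiset 𝒳 → Measure (Fin d → ℝ) :=
  poissonSampled q₁ (coordinateSampling F CP σ q₂)

end

/-! Couple the two neighbouring inputs by giving them the same Poisson sample `S` of the common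
datapoints. With P = κ S and Q = κ (x ::ₘ S), it remains to compare P with (1-q)P + qQ: moments of
densities are jointly convex (`HasMomentBound.add`), so a bound uniform in `S` survives averaging.

Let f = dQ/dP, s = 1-q+qf and α = n+2. In one direction ∫ s^α dP expands binomially, and ∫ f^v dP is
bounded by hypothesis. In the other direction the integral is ∫ s^(-(α-1)) dP, which has no such
expansion. `inv_affine_pow_le` bounds its integrand by a convex combination of s^α and f(1-q+q/f)^α
plus a multiple of f-1. The last term integrates to 0; the other two expand into moments of dQ/dP
and dP/dQ, both controlled because adjacency is symmetric. Hence both directions get the same bound.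
-/

/-! ### A pointwise inequality for reciprocal powers. -/

/-- Weighted AM-GM and concavity of `log`; up to a positive factor, the two sides are the second
derivatives (in `u`) of those of `inv_affine_pow_le`. -/
lemma inv_affine_pow_le_mix (n : ℕ) {q u : ℝ} (hq0 : 0 ≤ q) (hq1 : q ≤ 1) (hu : 0 < u) :
    ((1 - q + q * u)⁻¹) ^ (n + 3) ≤
      3 * (1 - q) / (3 + 2 * n * q) * (1 - q + q * u) ^ n +
        (2 * n + 3) * q / (3 + 2 * n * q) * (u⁻¹ ^ 3 * (1 - q + q * u⁻¹) ^ n) := by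
  have hD : 0 < 3 + 2 * n * q := by positivity
  have hq1' : 0 ≤ 1 - q := by linarith
  have pos : ∀ {x : ℝ}, 0 < x → 0 < 1 - q + q * x := by
    intro x hx
    rcases hq1.eq_or_lt with rfl | h
    · simpa using hx
    · have : 0 ≤ q * x := by positivity
      linarith
  have conc : ∀ {x : ℝ}, 0 < x → q * Real.log x ≤ Real.log (1 - q + q * x) := by
    intro x hx
    have := strictConcaveOn_log_Ioi.concaveOn.2 (Set.mem_Ioi.2 one_pos) (Set.mem_Ioi.2 hx)
      hq1' hq0 (by ring)
    simpa using this
  have hs := pos hu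
  have hw := pos (inv_pos.2 hu)
  have ls := conc hu
  have lw := conc (inv_pos.2 hu)
  rw [Real.log_inv] at lw
  set s := 1 - q + q * u
  set w := 1 - q + q * u⁻¹
  have e1 : s ^ n = Real.exp (n * Real.log s) := by
    rw [Real.exp_nat_mul, Real.exp_log hs]
  have e2 : u⁻¹ ^ 3 * w ^ n = Real.exp (n * Real.log w - 3 * Real.log u) := by
    rw [sub_eq_add_neg, Real.exp_add, Real.exp_nat_mul, Real.exp_log hw, Real.exp_neg,
      show (3 : ℝ) = ((3 : ℕ) : ℝ) by norm_num, Real.exp_nat_mul, Real.exp_log hu]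
    simp [mul_comm]
  have e3 : s⁻¹ ^ (n + 3) = Real.exp (-((n + 3) * Real.log s)) := by
    rw [Real.exp_neg, show ((n : ℝ) + 3) = ((n + 3 : ℕ) : ℝ) by norm_num, Real.exp_nat_mul,
      Real.exp_log hs, inv_pow]
  have key := convexOn_exp.2 (Set.mem_univ (n * Real.log s))
    (Set.mem_univ (n * Real.log w - 3 * Real.log u))
    (show 0 ≤ 3 * (1 - q) / (3 + 2 * n * q) by positivity)
    (show 0 ≤ (2 * n + 3) * q / (3 + 2 * n * q) by positivity) (by field_simp; ring)
  rw [e1, e2, e3]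
  refine le_trans (Real.exp_le_exp.2 ?_) key
  -- The weights are those for which `log u`, whose sign is arbitrary, cancels once `log s` and `log
  -- w` are replaced by their lower bounds ± q log u.
  have h1 : 0 ≤ (3 + n * q) * (Real.log s - q * Real.log u) +
      q * n * (Real.log w + q * Real.log u) := by
    have : 0 ≤ Real.log s - q * Real.log u := by linarith
    have : 0 ≤ Real.log w + q * Real.log u := by linarith
    positivity
  have h2 : 3 * (1 - q) / (3 + 2 * n * q) * (n * Real.log s) +
      (2 * n + 3) * q / (3 + 2 * n * q) * (n * Real.log w - 3 * Real.log u)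
      - -((n + 3) * Real.log s) = (2 * n + 3) / (3 + 2 * n * q) *
      ((3 + n * q) * (Real.log s - q * Real.log u) + q * n * (Real.log w + q * Real.log u)) := by
    field_simp
    ring
  have h3 : 0 ≤ (2 * n + 3 : ℝ) / (3 + 2 * n * q) := by positivity
  have := mul_nonneg h3 h1
  rw [← h2] at this
  simp only [smul_eq_mul]
  linarith

/-- The Bernstein-type bound behind the reverse direction of the amplification theorem: the linear
term vanishes in expectation when `u` is a probability density. -/
lemma inv_affine_pow_le (n : ℕ) {q : ℝ} (hq0 : 0 ≤ q) (hq1 : q ≤ 1) :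
    ∃ l c : ℝ, 0 ≤ l ∧ l ≤ 1 ∧ ∀ u : ℝ, 0 < u →
      ((1 - q + q * u)⁻¹) ^ (n + 1) ≤ l * (1 - q + q * u) ^ (n + 2) +
        (1 - l) * (u * (1 - q + q * u⁻¹) ^ (n + 2)) + c * (u - 1) := by
  have hq1' : 0 ≤ 1 - q := by linarith
  have hD : 0 < 3 + 2 * n * q := by positivity
  set l := 3 * (1 - q) / (3 + 2 * n * q) with hl
  have hl' : 1 - l = (2 * n + 3) * q / (3 + 2 * n * q) := by
    rw [hl]; field_simp; ring
  have hl1 : 0 ≤ 1 - l := by rw [hl']; positivity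
  have pos : ∀ {x : ℝ}, 0 < x → 0 < 1 - q + q * x := by
    intro x hx
    rcases hq1.eq_or_lt with rfl | h
    · simpa using hx
    · have : 0 ≤ q * x := by positivity
      linarith
  -- Chosen so that `H1 1 = 0`: the convex function `H` below then attains its minimum, 0, at 1.
  let c : ℝ := -(l * ((n + 2) * q) + (1 - l) * (1 - (n + 2) * q) + (n + 1) * q)
  refine ⟨l, c, by positivity, by linarith, fun u hu => ?_⟩
  let H : ℝ → ℝ := fun u => l * (1 - q + q * u) ^ (n + 2) +
    (1 - l) * (u * (1 - q + q * u⁻¹) ^ (n + 2)) + c * (u - 1) - ((1 - q + q * u)⁻¹) ^ (n + 1)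
  let H1 : ℝ → ℝ := fun u => l * ((n + 2) * q * (1 - q + q * u) ^ (n + 1)) +
    (1 - l) * ((1 - q + q * u⁻¹) ^ (n + 2) - (n + 2) * q * u⁻¹ * (1 - q + q * u⁻¹) ^ (n + 1)) + c
    + (n + 1) * q * ((1 - q + q * u)⁻¹) ^ (n + 2)
  let H2 : ℝ → ℝ := fun u => (n + 2) * (n + 1) * q ^ 2 * (l * (1 - q + q * u) ^ n +
    (1 - l) * (u⁻¹ ^ 3 * (1 - q + q * u⁻¹) ^ n) - ((1 - q + q * u)⁻¹) ^ (n + 3))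
  have dS : ∀ x : ℝ, HasDerivAt (fun u : ℝ => 1 - q + q * u) q x := fun x => by
    simpa using ((hasDerivAt_id x).const_mul q).const_add (1 - q)
  have dI : ∀ x : ℝ, 0 < x → HasDerivAt (fun u : ℝ => u⁻¹) (-x⁻¹ ^ 2) x := fun x hx => by
    simpa using hasDerivAt_inv hx.ne'
  have dW : ∀ x : ℝ, 0 < x → HasDerivAt (fun u : ℝ => 1 - q + q * u⁻¹) (-q * x⁻¹ ^ 2) x :=
    fun x hx => (((dI x hx).const_mul q).const_add (1 - q)).congr_deriv (by ring)
  have dT : ∀ x : ℝ, 0 < x → HasDerivAt (fun u : ℝ => (1 - q + q * u)⁻¹)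
      (-q * (1 - q + q * x)⁻¹ ^ 2) x := fun x hx =>
    ((dS x).inv (pos hx).ne').congr_deriv (by rw [div_eq_mul_inv, inv_pow])
  have d1 : ∀ x : ℝ, 0 < x → HasDerivAt H (H1 x) x := by
    intro x hx
    have := (((((dS x).pow (n + 2)).const_mul l).add
      (((hasDerivAt_id x).mul ((dW x hx).pow (n + 2))).const_mul (1 - l))).add
      (((hasDerivAt_id x).sub_const 1).const_mul c)).sub ((dT x hx).pow (n + 1))
    refine this.congr_deriv ?_
    have hx' : x * x⁻¹ = 1 := mul_inv_cancel₀ hx.ne'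
    simp only [H1, id, Nat.add_sub_cancel, show n + 2 - 1 = n + 1 by omega, Pi.pow_apply]
    push_cast
    linear_combination (1 - l) * (n + 2) * (1 - q + q * x⁻¹) ^ (n + 1) * (-q * x⁻¹) * hx'
  have d2 : ∀ x : ℝ, 0 < x → HasDerivAt H1 (H2 x) x := by
    intro x hx
    have := ((((((dS x).pow (n + 1)).const_mul ((n + 2) * q)).const_mul l).add
      ((((dW x hx).pow (n + 2)).sub ((((dI x hx).const_mul ((n + 2) * q))).mul
        ((dW x hx).pow (n + 1)))).const_mul (1 - l))).add_const c).add
      (((dT x hx).pow (n + 2)).const_mul ((n + 1) * q))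
    refine this.congr_deriv ?_
    simp only [H2, Nat.add_sub_cancel, show n + 2 - 1 = n + 1 by omega, Pi.pow_apply]
    push_cast
    ring
  have nn : ∀ x : ℝ, 0 < x → 0 ≤ H2 x := by
    intro x hx
    have := inv_affine_pow_le_mix n hq0 hq1 hx
    rw [← hl, ← hl'] at this
    refine mul_nonneg (by positivity) (by linarith)
  have conv : ConvexOn ℝ (Set.Ioi 0) H := by
    refine convexOn_of_hasDerivWithinAt2_nonneg (f' := H1) (f'' := H2) (convex_Ioi 0)
      (fun x hx => (d1 x hx).continuousAt.continuousWithinAt) ?_ ?_ ?_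
    · intro x hx; rw [interior_Ioi] at *; exact (d1 x hx).hasDerivWithinAt
    · intro x hx; rw [interior_Ioi] at *; exact (d2 x hx).hasDerivWithinAt
    · intro x hx; rw [interior_Ioi] at *; exact nn x hx
  have z0 : H 1 = 0 := by simp [H]
  have z1 : H1 1 = 0 := by simp [H1, c]; ring
  have hmin : IsMinOn H (Set.Ioi 0) 1 := by
    refine conv.isMinOn_of_rightDeriv_eq_zero (by simp) ?_
    rw [(d1 1 one_pos).hasDerivWithinAt.derivWithin (uniqueDiffWithinAt_Ioi 1), z1]
  have := isMinOn_iff.1 hmin u hu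
  simp only [z0, H] at this
  linarith

/-! ### Moment bounds for densities and their joint convexity. -/

/-- `P` has a density `f` with respect to `Q` whose `n`-th moment is at most `C`. -/
def HasMomentBound {Ω : Type*} [MeasurableSpace Ω] (n : ℕ) (P Q : Measure Ω) (C : ℝ≥0∞) : Prop :=
  ∃ f : Ω → ℝ≥0∞, Measurable f ∧ P = Q.withDensity f ∧ ∫⁻ o, f o ^ n ∂Q ≤ C

namespace HasMomentBound

variable {Ω : Type*} [MeasurableSpace Ω] {n : ℕ} {P Q P' Q' : Measure Ω} {C C' : ℝ≥0∞}

lemma absolutelyContinuous (h : HasMomentBound n P Q C) : P ≪ Q := by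
  obtain ⟨f, -, rfl, -⟩ := h
  exact withDensity_absolutelyContinuous _ _

lemma lintegral_le [SigmaFinite Q] (h : HasMomentBound n P Q C) {g : Ω → ℝ≥0∞}
    (hg : Measurable g) (hP : P = Q.withDensity g) : ∫⁻ o, g o ^ n ∂Q ≤ C := by
  obtain ⟨f, hf, rfl, hC⟩ := h
  have h1 := Q.rnDeriv_withDensity hf
  have h2 := Q.rnDeriv_withDensity hg
  rw [← hP] at h2
  refine (lintegral_congr_ae ?_).trans_le hC
  filter_upwards [h1, h2] with x h1 h2
  rw [← h2, h1]

lemma iff_rnDeriv [SigmaFinite P] [SigmaFinite Q] :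
    HasMomentBound n P Q C ↔ P ≪ Q ∧ ∫⁻ o, P.rnDeriv Q o ^ n ∂Q ≤ C := by
  refine ⟨fun h => ⟨h.absolutelyContinuous, h.lintegral_le (Measure.measurable_rnDeriv _ _) ?_⟩,
    fun h => ⟨_, Measure.measurable_rnDeriv _ _, ?_, h.2⟩⟩
  · exact (Measure.withDensity_rnDeriv_eq _ _ h.absolutelyContinuous).symm
  · exact (Measure.withDensity_rnDeriv_eq _ _ h.1).symm

lemma smul (c : ℝ≥0) (h : HasMomentBound n P Q C) :
    HasMomentBound n (c • P) (c • Q) (c * C) := by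
  obtain ⟨f, hf, rfl, hC⟩ := h
  refine ⟨f, hf, (withDensity_smul_measure _ _).symm, ?_⟩
  rw [lintegral_smul_measure]
  exact mul_le_mul_right hC _

/-- The densities g, g' of Q, Q' in Q + Q' sum to 1 almost everywhere, so P + P' has density g f +
g' f', a pointwise average; apply Jensen to t ↦ t^n. -/
lemma add [IsFiniteMeasure Q] [IsFiniteMeasure Q'] (hn : 1 ≤ n) (h : HasMomentBound n P Q C)
    (h' : HasMomentBound n P' Q' C') : HasMomentBound n (P + P') (Q + Q') (C + C') := by
  obtain ⟨f, hf, rfl, hC⟩ := h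
  obtain ⟨f', hf', rfl, hC'⟩ := h'
  have hac : Q ≪ Q + Q' := Measure.le_add_right le_rfl |>.absolutelyContinuous
  have hac' : Q' ≪ Q + Q' := Measure.le_add_left le_rfl |>.absolutelyContinuous
  set g := Q.rnDeriv (Q + Q')
  set g' := Q'.rnDeriv (Q + Q')
  have hg : Measurable g := Measure.measurable_rnDeriv _ _
  have hg' : Measurable g' := Measure.measurable_rnDeriv _ _
  have eg : (Q + Q').withDensity g = Q := Measure.withDensity_rnDeriv_eq _ _ hac
  have eg' : (Q + Q').withDensity g' = Q' := Measure.withDensity_rnDeriv_eq _ _ hac'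
  have hsum : ∀ᵐ x ∂(Q + Q'), g x + g' x = 1 := by
    filter_upwards [Measure.rnDeriv_add Q Q' (Q + Q'), Measure.rnDeriv_self (Q + Q')] with x h1 h2
    rw [← h2, h1]; rfl
  refine ⟨fun x => g x * f x + g' x * f' x, by fun_prop, ?_, ?_⟩
  · have e1 : Q.withDensity f = (Q + Q').withDensity (g * f) := by
      rw [withDensity_mul _ hg hf, eg]
    have e2 : Q'.withDensity f' = (Q + Q').withDensity (g' * f') := by
      rw [withDensity_mul _ hg' hf', eg']
    rw [e1, e2, ← withDensity_add_left (hg.mul hf)]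
    rfl
  · have e1 : ∫⁻ o, f o ^ n ∂Q = ∫⁻ o, g o * f o ^ n ∂(Q + Q') := by
      conv_lhs => rw [← eg]
      exact lintegral_withDensity_eq_lintegral_mul _ hg (hf.pow_const n)
    have e2 : ∫⁻ o, f' o ^ n ∂Q' = ∫⁻ o, g' o * f' o ^ n ∂(Q + Q') := by
      conv_lhs => rw [← eg']
      exact lintegral_withDensity_eq_lintegral_mul _ hg' (hf'.pow_const n)
    calc ∫⁻ x, (g x * f x + g' x * f' x) ^ n ∂(Q + Q')
        ≤ ∫⁻ x, g x * f x ^ n + g' x * f' x ^ n ∂(Q + Q') := by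
          refine lintegral_mono_ae ?_
          filter_upwards [hsum] with x hx
          simpa using ENNReal.rpow_arith_mean_le_arith_mean2_rpow (g x) (g' x) (f x) (f' x) hx
            (p := n) (by exact_mod_cast hn)
      _ = ∫⁻ o, f o ^ n ∂Q + ∫⁻ o, f' o ^ n ∂Q' := by
          rw [e1, e2, lintegral_add_left (by fun_prop)]
      _ ≤ C + C' := add_le_add hC hC'

end HasMomentBound

/-! ### Poisson sampling as a mixture. -/

section Poisson

variable {𝒳 Ω : Type*} [MeasurableSpace Ω] (q : unitInterval)

lemma poissonSampled_zero (κ : Multiset 𝒳 → Measure Ω) : poissonSampled q κ 0 = κ 0 := by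
  simp [poissonSampled]

lemma poissonSampled_cons (κ : Multiset 𝒳 → Measure Ω) (x : 𝒳) (X : Multiset 𝒳) :
    poissonSampled q κ (x ::ₘ X) =
      unitInterval.toNNReal (unitInterval.symm q) • poissonSampled q κ X +
        unitInterval.toNNReal q • poissonSampled q (fun S => κ (x ::ₘ S)) X := by
  simp only [poissonSampled, Multiset.powerset_cons, Multiset.map_add, Multiset.sum_add,
    Multiset.smul_sum, Multiset.map_map, Function.comp_def, Multiset.card_cons]
  congr 2 <;> refine Multiset.map_congr rfl fun S hS => ?_
  · have : S.card ≤ X.card := Multiset.card_le_card (Multiset.mem_powerset.1 hS)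
    rw [smul_smul, Nat.succ_sub this, pow_succ]
    congr 1
    ring
  · rw [smul_smul, Nat.add_sub_add_right, pow_succ]
    congr 1
    ring

lemma poissonSampled_smul_add_smul (a b : ℝ≥0) (κ κ' : Multiset 𝒳 → Measure Ω)
    (X : Multiset 𝒳) :
    poissonSampled q (fun S => a • κ S + b • κ' S) X =
      a • poissonSampled q κ X + b • poissonSampled q κ' X := by
  induction X using Multiset.induction generalizing κ κ' with
  | empty => simp [poissonSampled_zero]
  | cons x X ih =>
    simp only [poissonSampled_cons, ih]
    module

/-- Deciding about `x` last leaves both neighbours as mixtures over the same samples of `X`, with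
the same weights. -/
lemma poissonSampled_cons' (κ : Multiset 𝒳 → Measure Ω) (x : 𝒳) (X : Multiset 𝒳) :
    poissonSampled q κ (x ::ₘ X) =
      poissonSampled q (fun S => unitInterval.toNNReal (unitInterval.symm q) • κ S +
        unitInterval.toNNReal q • κ (x ::ₘ S)) X := by
  rw [poissonSampled_cons, poissonSampled_smul_add_smul]

lemma isProbabilityMeasure_smul_add_smul (q : unitInterval) (P Q : Measure Ω)
    [IsProbabilityMeasure P] [IsProbabilityMeasure Q] :
    IsProbabilityMeasure (unitInterval.toNNReal (unitInterval.symm q) • P +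
      unitInterval.toNNReal q • Q) := by
  constructor
  rw [Measure.add_apply, Measure.smul_apply, Measure.smul_apply, measure_univ, measure_univ,
    ← add_smul, unitInterval.toNNReal_symm_add_toNNReal, one_smul]

lemma isProbabilityMeasure_poissonSampled (κ : Multiset 𝒳 → Measure Ω)
    (hκ : ∀ S, IsProbabilityMeasure (κ S)) (X : Multiset 𝒳) :
    IsProbabilityMeasure (poissonSampled q κ X) := by
  induction X using Multiset.induction generalizing κ with
  | empty => rw [poissonSampled_zero]; exact hκ 0
  | cons x X ih =>
    rw [poissonSampled_cons]
    have := ih κ hκ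
    have := ih (fun S => κ (x ::ₘ S)) fun S => hκ _
    exact isProbabilityMeasure_smul_add_smul _ _ _

lemma HasMomentBound.poissonSampled {n : ℕ} (hn : 1 ≤ n) {C : ℝ≥0∞}
    {κ κ' : Multiset 𝒳 → Measure Ω} (hκ' : ∀ S, IsProbabilityMeasure (κ' S))
    (h : ∀ S, HasMomentBound n (κ S) (κ' S) C) (X : Multiset 𝒳) :
    HasMomentBound n (poissonSampled q κ X) (poissonSampled q κ' X) C := by
  induction X using Multiset.induction generalizing κ κ' with
  | empty => simpa only [poissonSampled_zero] using h 0
  | cons x X ih =>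
    rw [poissonSampled_cons, poissonSampled_cons]
    have := isProbabilityMeasure_poissonSampled q κ' hκ' X
    have := isProbabilityMeasure_poissonSampled q (fun S => κ' (x ::ₘ S)) (fun S => hκ' _) X
    have key := HasMomentBound.add hn
      ((ih hκ' h).smul (unitInterval.toNNReal (unitInterval.symm q)))
      ((ih (fun S => hκ' (x ::ₘ S)) fun S => h (x ::ₘ S)).smul (unitInterval.toNNReal q))
    rwa [← add_mul, ← ENNReal.coe_add, unitInterval.toNNReal_symm_add_toNNReal, ENNReal.coe_one,
      one_mul] at key

end Poisson

/-! ### Comparing a law with its two-point mixture. -/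

section Density

variable {Ω : Type*} [MeasurableSpace Ω]

lemma exists_pos_density (P Q : Measure Ω) [SigmaFinite P] [SigmaFinite Q] (hPQ : P ≪ Q)
    (hQP : Q ≪ P) : ∃ f : Ω → ℝ, Measurable f ∧ (∀ x, 0 < f x) ∧
      Q = P.withDensity (fun x => ENNReal.ofReal (f x)) := by
  classical
  -- The default 1 is taken only where the derivative is 0 or ∞, a `P`-null set by mutual absolute
  -- continuity.
  refine ⟨fun x => if 0 < (Q.rnDeriv P x).toReal then (Q.rnDeriv P x).toReal else 1,
    Measurable.ite (measurableSet_lt measurable_const (Measure.measurable_rnDeriv _ _).ennreal_toReal)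
      (Measure.measurable_rnDeriv _ _).ennreal_toReal measurable_const,
    fun x => by dsimp only; split_ifs with h; exacts [h, one_pos], ?_⟩
  conv_lhs => rw [← Measure.withDensity_rnDeriv_eq _ _ hQP]
  refine withDensity_congr_ae ?_
  filter_upwards [Q.rnDeriv_ne_top P, Measure.rnDeriv_pos' hPQ] with x h1 h2
  rw [if_pos (ENNReal.toReal_pos h2.ne' h1), ENNReal.ofReal_toReal h1]

lemma withDensity_ofReal_inv (P : Measure Ω) {f : Ω → ℝ} (hf : Measurable f)
    (hpos : ∀ x, 0 < f x) :
    P = (P.withDensity fun x => ENNReal.ofReal (f x)).withDensity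
      (fun x => ENNReal.ofReal (f x)⁻¹) := by
  have := withDensity_inv_same (μ := P) hf.ennreal_ofReal
    (.of_forall fun x => (ENNReal.ofReal_pos.2 (hpos x)).ne')
    (.of_forall fun x => ENNReal.ofReal_ne_top)
  simp_rw [← ENNReal.ofReal_inv_of_pos (hpos _)] at this
  exact this.symm

lemma lintegral_ofReal_inv_pow (P : Measure Ω) {f : Ω → ℝ} (hf : Measurable f)
    (hpos : ∀ x, 0 < f x) (n : ℕ) :
    ∫⁻ x, ENNReal.ofReal (f x)⁻¹ ^ n ∂(P.withDensity fun x => ENNReal.ofReal (f x)) =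
      ∫⁻ x, ENNReal.ofReal (f x * (f x)⁻¹ ^ n) ∂P := by
  rw [lintegral_withDensity_eq_lintegral_mul _ hf.ennreal_ofReal (by fun_prop)]
  refine lintegral_congr fun x => ?_
  have := hpos x
  rw [ENNReal.ofReal_mul (hpos x).le, ENNReal.ofReal_pow (by positivity)]
  rfl

lemma smul_add_smul_withDensity (q : unitInterval) (P : Measure Ω) {f : Ω → ℝ}
    (hf : Measurable f) (hpos : ∀ x, 0 < f x) :
    unitInterval.toNNReal (unitInterval.symm q) • P +
        unitInterval.toNNReal q • P.withDensity (fun x => ENNReal.ofReal (f x)) =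
      P.withDensity (fun x => ENNReal.ofReal (1 - q + q * f x)) := by
  have hq : ((unitInterval.toNNReal q : ℝ≥0) : ℝ≥0∞) = ENNReal.ofReal q := by
    rw [← unitInterval.coe_toNNReal, ENNReal.ofReal_coe_nnreal]
  have hq' : ((unitInterval.toNNReal (unitInterval.symm q) : ℝ≥0) : ℝ≥0∞) =
      ENNReal.ofReal (1 - q) := by
    rw [← unitInterval.coe_symm_eq, ← unitInterval.coe_toNNReal, ENNReal.ofReal_coe_nnreal]
  have e : (fun x => ENNReal.ofReal (1 - q + q * f x)) =
      (fun _ => ENNReal.ofReal (1 - q)) + ENNReal.ofReal q • fun x => ENNReal.ofReal (f x) := by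
    funext x
    simp only [Pi.add_apply, Pi.smul_apply, smul_eq_mul]
    rw [← ENNReal.ofReal_mul q.2.1,
      ← ENNReal.ofReal_add (sub_nonneg.2 q.2.2) (mul_nonneg q.2.1 (hpos x).le)]
  rw [e, withDensity_add_left measurable_const, withDensity_const,
    withDensity_smul _ hf.ennreal_ofReal, ← hq, ← hq']
  rfl

lemma one_sub_add_mul_pos (q : unitInterval) {x : ℝ} (hx : 0 < x) :
    0 < 1 - (q : ℝ) + q * x := by
  have h0 := q.2.1
  rcases q.2.2.eq_or_lt with h | h
  · simpa [h] using hx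
  · have : 0 ≤ (q : ℝ) * x := by positivity
    linarith

/-- Both binomial expansions have the same coefficients and the same moment bounds `E v`, so the
weight `l` disappears from the result. -/
lemma lintegral_mix_le (P : Measure Ω) {f : Ω → ℝ} (hf : Measurable f) (hpos : ∀ x, 0 < f x)
    (q : unitInterval) (n : ℕ) (E : ℕ → ℝ≥0∞)
    (hA : ∀ v ≤ n, ∫⁻ x, ENNReal.ofReal (f x ^ v) ∂P ≤ E v)
    (hB : ∀ v ≤ n, ∫⁻ x, ENNReal.ofReal (f x * (f x)⁻¹ ^ v) ∂P ≤ E v)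
    {l : ℝ} (hl0 : 0 ≤ l) (hl1 : l ≤ 1) :
    ∫⁻ x, ENNReal.ofReal (l * (1 - q + q * f x) ^ n +
      (1 - l) * (f x * (1 - q + q * (f x)⁻¹) ^ n)) ∂P ≤
    ∑ v ∈ Finset.range (n + 1),
      ENNReal.ofReal (n.choose v * (1 - (q : ℝ)) ^ (n - v) * (q : ℝ) ^ v) * E v := by
  have h0 := q.2.1
  have h1 : 0 ≤ 1 - (q : ℝ) := sub_nonneg.2 q.2.2
  have h2 : 0 ≤ 1 - l := sub_nonneg.2 hl1
  have e : ∀ x, ENNReal.ofReal (l * (1 - q + q * f x) ^ n +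
      (1 - l) * (f x * (1 - q + q * (f x)⁻¹) ^ n)) =
      ∑ v ∈ Finset.range (n + 1),
      ENNReal.ofReal (n.choose v * (1 - (q : ℝ)) ^ (n - v) * (q : ℝ) ^ v) *
        (ENNReal.ofReal l * ENNReal.ofReal (f x ^ v) +
          ENNReal.ofReal (1 - l) * ENNReal.ofReal (f x * (f x)⁻¹ ^ v)) := by
    intro x
    have hx := hpos x
    have e1 : ∀ v, ENNReal.ofReal (n.choose v * (1 - (q : ℝ)) ^ (n - v) * (q : ℝ) ^ v) *
        (ENNReal.ofReal l * ENNReal.ofReal (f x ^ v) +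
          ENNReal.ofReal (1 - l) * ENNReal.ofReal (f x * (f x)⁻¹ ^ v)) =
        ENNReal.ofReal (n.choose v * (1 - (q : ℝ)) ^ (n - v) * (q : ℝ) ^ v *
          (l * f x ^ v + (1 - l) * (f x * (f x)⁻¹ ^ v))) := by
      intro v
      rw [← ENNReal.ofReal_mul hl0, ← ENNReal.ofReal_mul h2,
        ← ENNReal.ofReal_add (by positivity) (by positivity),
        ← ENNReal.ofReal_mul (by positivity)]
    simp_rw [e1]
    rw [← ENNReal.ofReal_sum_of_nonneg (fun v _ => by positivity), add_comm (1 - (q : ℝ)) (q * f x),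
      add_comm (1 - (q : ℝ)) (q * (f x)⁻¹), add_pow, add_pow]
    congr 1
    simp only [Finset.mul_sum, ← Finset.sum_add_distrib]
    refine Finset.sum_congr rfl fun v _ => ?_
    rw [mul_pow, mul_pow]
    ring
  simp_rw [e]
  rw [lintegral_finsetSum _ (fun v _ => by fun_prop)]
  refine Finset.sum_le_sum fun v hv => ?_
  have hv : v ≤ n := Finset.mem_range_succ_iff.1 hv
  rw [lintegral_const_mul _ (by fun_prop), lintegral_add_left (by fun_prop),
    lintegral_const_mul _ (by fun_prop), lintegral_const_mul _ (by fun_prop)]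
  refine mul_le_mul_right ?_ _
  calc _ ≤ ENNReal.ofReal l * E v + ENNReal.ofReal (1 - l) * E v :=
        add_le_add (mul_le_mul_right (hA v hv) _) (mul_le_mul_right (hB v hv) _)
    _ = E v := by
        rw [← add_mul, ← ENNReal.ofReal_add hl0 h2, add_sub_cancel, ENNReal.ofReal_one, one_mul]

lemma lintegral_inv_affine_pow_le (P : Measure Ω) [IsProbabilityMeasure P] {f : Ω → ℝ}
    (hf : Measurable f) (hpos : ∀ x, 0 < f x) (hint : ∫⁻ x, ENNReal.ofReal (f x) ∂P = 1)
    (q : unitInterval) (n : ℕ) (E : ℕ → ℝ≥0∞)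
    (hA : ∀ v ≤ n + 2, ∫⁻ x, ENNReal.ofReal (f x ^ v) ∂P ≤ E v)
    (hB : ∀ v ≤ n + 2, ∫⁻ x, ENNReal.ofReal (f x * (f x)⁻¹ ^ v) ∂P ≤ E v) :
    ∫⁻ x, ENNReal.ofReal ((1 - q + q * f x)⁻¹ ^ (n + 1)) ∂P ≤
    ∑ v ∈ Finset.range (n + 3),
      ENNReal.ofReal ((n + 2).choose v * (1 - (q : ℝ)) ^ (n + 2 - v) * (q : ℝ) ^ v) * E v := by
  obtain ⟨l, c, hl0, hl1, h⟩ := inv_affine_pow_le n q.2.1 q.2.2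
  refine le_trans ?_ (lintegral_mix_le P hf hpos q (n + 2) E hA hB hl0 hl1)
  have h2 : 0 ≤ 1 - l := sub_nonneg.2 hl1
  -- To stay in `ℝ≥0∞`, c(f - 1) is split into positive and negative parts distributed over both
  -- sides. As ∫ f dP = 1, each side gains the same finite constant, which cancels.
  have hpt : ∀ x, ENNReal.ofReal ((1 - q + q * f x)⁻¹ ^ (n + 1)) +
      (ENNReal.ofReal (max (-c) 0) * ENNReal.ofReal (f x) + ENNReal.ofReal (max c 0)) ≤
      ENNReal.ofReal (l * (1 - q + q * f x) ^ (n + 2) +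
        (1 - l) * (f x * (1 - q + q * (f x)⁻¹) ^ (n + 2))) +
      (ENNReal.ofReal (max c 0) * ENNReal.ofReal (f x) + ENNReal.ofReal (max (-c) 0)) := by
    intro x
    have hx := hpos x
    have hs := one_sub_add_mul_pos q hx
    have hw := one_sub_add_mul_pos q (inv_pos.2 hx)
    have hc : max c 0 - max (-c) 0 = c := by
      rcases le_total 0 c with hc | hc
      · rw [max_eq_left hc, max_eq_right (by linarith), sub_zero]
      · rw [max_eq_right hc, max_eq_left (by linarith), zero_sub, neg_neg]
    have hc1 : 0 ≤ max c 0 := le_max_right _ _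
    have hc2 : 0 ≤ max (-c) 0 := le_max_right _ _
    rw [← ENNReal.ofReal_mul hc1, ← ENNReal.ofReal_mul hc2,
      ← ENNReal.ofReal_add (by positivity) (by positivity),
      ← ENNReal.ofReal_add (by positivity) (by positivity),
      ← ENNReal.ofReal_add (by positivity) (by positivity),
      ← ENNReal.ofReal_add (by positivity) (by positivity)]
    refine ENNReal.ofReal_le_ofReal ?_
    have := h (f x) hx
    have e : c * (f x - 1) = (max c 0 - max (-c) 0) * (f x - 1) := by rw [hc]
    rw [e] at this
    linarith
  have hI := lintegral_mono (μ := P) hpt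
  have hmeas : Measurable fun x => ENNReal.ofReal ((1 - q + q * f x)⁻¹ ^ (n + 1)) := by fun_prop
  rw [lintegral_add_left hmeas, lintegral_add_left (by fun_prop),
    lintegral_add_left (by fun_prop),
    lintegral_add_right _ measurable_const,
    lintegral_const_mul _ (by fun_prop), lintegral_const_mul _ (by fun_prop), hint] at hI
  simp only [lintegral_const, measure_univ, mul_one] at hI
  rw [add_comm (ENNReal.ofReal (max c 0))] at hI
  exact (ENNReal.add_le_add_iff_right (by finiteness)).1 hI

lemma mixture_hasMomentBound (P Q : Measure Ω) [IsProbabilityMeasure P] [IsProbabilityMeasure Q]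
    (q : unitInterval) (n : ℕ) (E : ℕ → ℝ≥0∞) (hE0 : E 0 = 1) (hE1 : E 1 = 1)
    (hQP : ∀ v, 2 ≤ v → v ≤ n + 2 → HasMomentBound v Q P (E v))
    (hPQ : ∀ v, 2 ≤ v → v ≤ n + 2 → HasMomentBound v P Q (E v)) :
    HasMomentBound (n + 2) (unitInterval.toNNReal (unitInterval.symm q) • P +
        unitInterval.toNNReal q • Q) P (∑ v ∈ Finset.range (n + 3),
      ENNReal.ofReal ((n + 2).choose v * (1 - (q : ℝ)) ^ (n + 2 - v) * (q : ℝ) ^ v) * E v) ∧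
    HasMomentBound (n + 2) P (unitInterval.toNNReal (unitInterval.symm q) • P +
        unitInterval.toNNReal q • Q) (∑ v ∈ Finset.range (n + 3),
      ENNReal.ofReal ((n + 2).choose v * (1 - (q : ℝ)) ^ (n + 2 - v) * (q : ℝ) ^ v) * E v) := by
  obtain ⟨f, hf, hpos, hQ⟩ := exists_pos_density P Q
    (hPQ 2 le_rfl (by omega)).absolutelyContinuous (hQP 2 le_rfl (by omega)).absolutelyContinuous
  have hint : ∫⁻ x, ENNReal.ofReal (f x) ∂P = 1 := by
    rw [← setLIntegral_univ, ← withDensity_apply _ MeasurableSet.univ, ← hQ, measure_univ]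
  have hA : ∀ v ≤ n + 2, ∫⁻ x, ENNReal.ofReal (f x ^ v) ∂P ≤ E v := by
    intro v hv
    match v with
    | 0 => simp [hE0]
    | 1 => simp [hE1, hint]
    | k + 2 =>
      have := (hQP (k + 2) (by omega) hv).lintegral_le hf.ennreal_ofReal hQ
      simpa only [ENNReal.ofReal_pow (hpos _).le] using this
  -- This is the v-th moment of dP/dQ = 1/f under Q = f P.
  have hB : ∀ v ≤ n + 2, ∫⁻ x, ENNReal.ofReal (f x * (f x)⁻¹ ^ v) ∂P ≤ E v := by
    intro v hv
    match v with
    | 0 => simp [hE0, hint]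
    | 1 => simp [hE1, mul_inv_cancel₀ (hpos _).ne']
    | k + 2 =>
      have := (hPQ (k + 2) (by omega) hv).lintegral_le (g := fun x => ENNReal.ofReal (f x)⁻¹)
        (by fun_prop) (by rw [hQ]; exact withDensity_ofReal_inv P hf hpos)
      rwa [hQ, lintegral_ofReal_inv_pow P hf hpos] at this
  have hs : ∀ x, 0 < 1 - (q : ℝ) + q * f x := fun x => one_sub_add_mul_pos q (hpos x)
  have hsm : Measurable fun x => 1 - (q : ℝ) + q * f x := by fun_prop
  rw [hQ, smul_add_smul_withDensity q P hf hpos]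
  constructor
  · refine ⟨_, hsm.ennreal_ofReal, rfl, ?_⟩
    -- The case l = 1, where only the moments of dQ/dP contribute.
    simpa [ENNReal.ofReal_pow (hs _).le] using
      lintegral_mix_le P hf hpos q (n + 2) E hA hB zero_le_one le_rfl
  · refine ⟨fun x => ENNReal.ofReal (1 - (q : ℝ) + q * f x)⁻¹, by fun_prop,
      withDensity_ofReal_inv P hsm hs, ?_⟩
    rw [lintegral_ofReal_inv_pow P hsm hs]
    convert lintegral_inv_affine_pow_le P hf hpos hint q n E hA hB using 4 with x
    rw [pow_succ' _ (n + 1), mul_inv_cancel_left₀ (hs x).ne']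

end Density

/-! ### From Rényi divergence to moments, and the theorem. -/

lemma renyiDivergence_le_iff {Ω : Type*} [MeasurableSpace Ω] (P Q : Measure Ω) [SigmaFinite P]
    [SigmaFinite Q] {n : ℕ} (hn : 2 ≤ n) (e : ℝ) :
    renyiDivergence n P Q ≤ (e : EReal) ↔
      HasMomentBound n P Q (ENNReal.ofReal (Real.exp ((n - 1) * e))) := by
  have hn' : (0 : ℝ) < n - 1 := by
    have : (2 : ℝ) ≤ n := by exact_mod_cast hn
    linarith
  rw [HasMomentBound.iff_rnDeriv, renyiDivergence]
  split_ifs with h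
  · simp only [h, true_and, ENNReal.rpow_natCast]
    rw [← EReal.exp_coe, ← ENNReal.log_le_log_iff, EReal.log_exp]
    set L := ENNReal.log (∫⁻ o, P.rnDeriv Q o ^ n ∂Q)
    have hc : (0 : EReal) < ((n - 1 : ℝ) : EReal) := by exact_mod_cast hn'
    rw [EReal.coe_inv, mul_comm, ← div_eq_mul_inv,
      EReal.div_le_iff_le_mul hc (EReal.coe_ne_top _), EReal.coe_mul]
  · simp [h]

theorem theorem6 {𝒳 : Type*} {d : ℕ} (F : 𝒳 → Fin d → ℝ) (CP : (Fin d → ℝ) → Fin d → ℝ)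
    (σ : ℝ≥0) (hσ : 0 < σ) (q₁ q₂ : unitInterval) (ε₀ : ℕ → ℝ)
    (h : ∀ α₀ : ℕ, 2 ≤ α₀ → IsRDP (coordinateSampling F CP σ q₂) (α₀ : ℝ) (ε₀ α₀)) :
    ∀ α : ℕ, 2 ≤ α →
      IsRDP (twiceSampling F CP σ q₁ q₂) (α : ℝ)
        (Real.log ((1 - (q₁ : ℝ)) ^ α +
            ∑ v ∈ Finset.Icc 1 α, (α.choose v : ℝ) * (1 - (q₁ : ℝ)) ^ (α - v) * (q₁ : ℝ) ^ v *
              Real.exp (((v : ℝ) - 1) * ε₀ v)) /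
          ((α : ℝ) - 1)) := by
  intro α hα
  have hprob : ∀ S, IsProbabilityMeasure (coordinateSampling F CP σ q₂ S) := by
    intro S
    have := fun l : Fin d => isProbabilityMeasure_poissonSampled q₂
      (fun S : Multiset 𝒳 => gaussianReal (S.map fun x => CP (F x) l).sum (σ ^ 2))
      (fun _ => inferInstance) S
    unfold coordinateSampling
    infer_instance
  have hprob' : ∀ S, IsProbabilityMeasure (twiceSampling F CP σ q₁ q₂ S) :=
    isProbabilityMeasure_poissonSampled q₁ _ hprob
  set κ := coordinateSampling F CP σ q₂ with hκ
  have h0 := q₁.2.1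
  have h1 : 0 ≤ 1 - (q₁ : ℝ) := sub_nonneg.2 q₁.2.2
  set R := (1 - (q₁ : ℝ)) ^ α +
    ∑ v ∈ Finset.Icc 1 α, (α.choose v : ℝ) * (1 - (q₁ : ℝ)) ^ (α - v) * (q₁ : ℝ) ^ v *
      Real.exp (((v : ℝ) - 1) * ε₀ v) with hR
  -- Needed for exp (log R) = R. When q₁ = 1 the positive term is v = α.
  have hRpos : 0 < R := by
    rcases q₁.2.2.eq_or_lt with hq | hq
    · refine add_pos_of_nonneg_of_pos (by positivity) (Finset.sum_pos' (fun v _ => by positivity)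
        ⟨α, Finset.mem_Icc.2 ⟨by omega, le_rfl⟩, ?_⟩)
      simp [hq, Real.exp_pos]
    · have : 0 < 1 - (q₁ : ℝ) := sub_pos.2 hq
      positivity
  -- The order-0 moment is 1, whereas the formula would give exp (-ε₀ 0); at v = 1 the formula
  -- already gives 1.
  let E : ℕ → ℝ≥0∞ := fun v =>
    if v = 0 then 1 else ENNReal.ofReal (Real.exp (((v : ℝ) - 1) * ε₀ v))
  have hRE : ∑ v ∈ Finset.range (α + 1),
      ENNReal.ofReal (α.choose v * (1 - (q₁ : ℝ)) ^ (α - v) * (q₁ : ℝ) ^ v) * E v =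
      ENNReal.ofReal R := by
    rw [hR, ENNReal.ofReal_add (by positivity) (Finset.sum_nonneg fun v _ => by positivity),
      ENNReal.ofReal_sum_of_nonneg (fun v _ => by positivity), Finset.range_eq_Ico,
      Finset.sum_eq_sum_Ico_succ_bot (by omega)]
    congr 1
    · simp [E]
    · refine Finset.sum_congr (by ext; simp) fun v hv => ?_
      have : v ≠ 0 := by simp at hv; omega
      simp only [E, if_neg this]
      rw [← ENNReal.ofReal_mul (by positivity)]
  obtain ⟨n, rfl⟩ : ∃ n, α = n + 2 := ⟨α - 2, by omega⟩
  have hmom : ∀ S S', AdjacentDatasets S S' → ∀ v, 2 ≤ v → HasMomentBound v (κ S) (κ S') (E v) := by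
    intro S S' hS v hv
    simpa [E, show v ≠ 0 by omega] using
      (renyiDivergence_le_iff (κ S) (κ S') hv (ε₀ v)).1 (h v hv S S' hS)
  have hmix : ∀ x S, _ := fun x S => mixture_hasMomentBound (κ S) (κ (x ::ₘ S)) q₁ n E
    (by simp [E]) (by simp [E]) (fun v hv _ => hmom _ _ ⟨x, .inl rfl⟩ v hv)
    (fun v hv _ => hmom _ _ ⟨x, .inr rfl⟩ v hv)
  simp only [hRE] at hmix
  intro X X' hX
  rw [renyiDivergence_le_iff _ _ hα, mul_div_cancel₀ _ (by push_cast; linarith [(n.cast_nonneg : (0 : ℝ) ≤ n)]),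
    Real.exp_log hRpos]
  obtain ⟨x, rfl | rfl⟩ := hX
  · unfold twiceSampling
    rw [poissonSampled_cons']
    exact HasMomentBound.poissonSampled q₁ (by omega) hprob (fun S => (hmix x S).1) X'
  · unfold twiceSampling
    rw [poissonSampled_cons']
    exact HasMomentBound.poissonSampled q₁ (by omega)
      (fun S => isProbabilityMeasure_smul_add_smul _ _ _) (fun S => (hmix x S).2) X
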